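/- Let $d\in\mathbb N$, let $A$ be a $d\times d$ complex matrix and let $\{A_{i,n} : 1\le i\le n,\ n\in\mathbb N\}$ be a triangular array of $d\times d$ complex matrices whose row averages converge, $\frac1n\sum_{i=1}^n A_{i,n}\to A$ as $n\to\infty$. Let $\|\cdot\|$ be the operator norm induced by the Euclidean norm on $\mathbb C^d$, and put \[ L^\infty_n=\max_{1\le i\le n}\|A_{i,n}\|,\qquad L^1_n=\frac1n\sum_{i=1}^n\|A_{i,n}\|. \] On some probability space let $\sigma_n$, for each $n$, be a random permutation of $\{1,\dots,n\}$ with the uniform distribution (with an arbitrary joint distribution for different $n$). If for some $\delta>0$ \[ (L^1_n)^{4+\delta}\,e^{3L^1_n}\,L^\infty_n=o(n)\qquad(n\to\infty), \] then, with the products taken in the order of increasing $i$, for every $\varepsilon>0$ \[ \mathbb P\Bigl(\Bigl\|\prod_{i=1}^{\lfloor tn\rfloor}e^{A_{\sigma_n(i),n}/n}-e^{tA}\Bigr\|<\varepsilon\ \text{ for all } 0\le t\le 1\Bigr)\longrightarrow 1\qquad(n\to\infty). \] If in addition \[ (L^1_n)^{3}\,e^{3L^1_n}\,L^\infty_n=o(n/\log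 n)\qquad(n\to\infty), \] then almost surely \[ \sup_{0\le t\le1}\Bigl\|\prod_{i=1}^{\lfloor tn\rfloor}e^{A_{\sigma_n(i),n}/n}-e^{tA}\Bigr\|\longrightarrow 0\qquad(n\to\infty). \] -/

import Mathlib

open Filter Topology Asymptotics MeasureTheory
open scoped ENNReal Nat

-- The norm on matrices is the operator norm coming from the Euclidean norm on `ℂ^d`.
open scoped Matrix.Norms.L2Operator

/-- The `d × d` complex matrices. -/
abbrev CMat (d : ℕ) : Type := Matrix (Fin d) (Fin d) ℂ

/-- A triangular array of `d × d` complex matrices: row `n` has `n` entries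
(indexed by `0, …, n - 1`). -/
abbrev TriArray (d : ℕ) : Type := (n : ℕ) → Fin n → CMat d

namespace TriArray

/-- The average of row `n`. -/
noncomputable def rowAvg {d : ℕ} (X : TriArray d) (n : ℕ) : CMat d :=
  (n : ℝ)⁻¹ • ∑ i : Fin n, X n i

/-- The maximal norm in row `n`. -/
noncomputable def normMax {d : ℕ} (X : TriArray d) (n : ℕ) : ℝ :=
  ⨆ i : Fin n, ‖X n i‖

/-- The average norm in row `n`. -/
noncomputable def normAvg {d : ℕ} (X : TriArray d) (n : ℕ) : ℝ :=
  (n : ℝ)⁻¹ * ∑ i : Fin n, ‖X n i‖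

/-- The ordered product, from left to right, of the first `⌊t n⌋` of the factors
`exp (X n (τ i) / n)`, for a permutation `τ` of the indices of row `n`. -/
noncomputable def permProd {d : ℕ} (X : TriArray d) (n : ℕ) (τ : Equiv.Perm (Fin n)) (t : ℝ) :
    CMat d :=
  ((List.ofFn fun i : Fin n => NormedSpace.exp ((n : ℝ)⁻¹ • X n (τ i))).take ⌊t * n⌋₊).prod

end TriArray

/-- For every `n`, `σ n` is a random permutation of `n` objects with the uniform distribution.
Nothing is assumed about the joint distribution for different `n`. -/
structure IsUniformPermSeq {Ω : Type*} [MeasurableSpace Ω] (P : Measure Ω)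
    (σ : (n : ℕ) → Ω → Equiv.Perm (Fin n)) : Prop where
  measurableSet_eq : ∀ (n : ℕ) (τ : Equiv.Perm (Fin n)), MeasurableSet {ω | σ n ω = τ}
  prob_eq : ∀ (n : ℕ) (τ : Equiv.Perm (Fin n)), P {ω | σ n ω = τ} = ((n ! : ℕ) : ℝ≥0∞)⁻¹

/-! ### Maximal inequalities for partial sums of a randomly ordered centred family. -/

section PermutationSums

variable {E : Type*} [AddCommGroup E]

/-! Noncommutativity is harmless once the partial sums of the exponents follow a straight line. If
these sums stay within `eta` of `k • D`, where `n • D` is the row mean, summation by parts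
(`norm_expProd_sub_exp_le`) puts every partial product within about `exp L * (eta + L * B / n)` of
`exp (k • D)`, up to a factor depending only on the mean; here `L` is the average norm and `B` the
maximal norm of the row. The means are bounded, so only one factor `exp L` can grow, and `eta` of
order `exp (-L)` suffices.

The partial sums of the centred entries, taken in random order, are sums drawn without replacement.
Divided by `n - k` they form a martingale, which gives a Bernstein bound and a Doob-type maximal
inequality on the first half of the times; reversing the order covers the second half. The terms are
at most `2 * B / n` and their squares sum to at most `4 * B * L / n`, so with `eta` of order `exp
(-L)` the proportion of bad orderings is at most a constant times `exp (-Lam / 4)` as soon as `Lam *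
exp (2 * L) * (1 + L) * B` is a small multiple of `n` (`TriArray.exists_card_badPerms_le`).

Rows with small `L` need no probability: both the products and the exponentials are near `1`. For
`L` bounded below, the growth hypotheses dominate the required quantity. An arbitrarily large
constant `Lam` gives convergence in probability; `Lam = 8 * log n` gives the summable bound `n ^
(-2)` and Borel–Cantelli applies. -/

/-- The sum of the first `k` terms of the family `x`, rearranged by the permutation `τ`. -/
def permPartialSum {n : ℕ} (x : Fin n → E) (k : ℕ) (τ : Equiv.Perm (Fin n)) : E :=
  ∑ i : Fin n with i.val < k, x (τ i)

/-- `g` only depends on the values of the permutation at the first `k` places. -/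
def DependsOnFirst {n : ℕ} {β : Type*} (k : ℕ) (g : Equiv.Perm (Fin n) → β) : Prop :=
  ∀ i j : Fin n, k ≤ i.val → k ≤ j.val → ∀ τ, g (τ * Equiv.swap i j) = g τ

theorem permPartialSum_zero {n : ℕ} (x : Fin n → E) (τ : Equiv.Perm (Fin n)) :
    permPartialSum x 0 τ = 0 := by
  simp [permPartialSum]

theorem permPartialSum_succ {n : ℕ} (x : Fin n → E) {k : ℕ} (hk : k < n)
    (τ : Equiv.Perm (Fin n)) :
    permPartialSum x (k + 1) τ = permPartialSum x k τ + x (τ ⟨k, hk⟩) := by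
  unfold permPartialSum
  have : (Finset.univ.filter fun i : Fin n => i.val < k + 1)
      = insert ⟨k, hk⟩ (Finset.univ.filter fun i : Fin n => i.val < k) := by
    ext i; simp [Fin.ext_iff]; omega
  rw [this, Finset.sum_insert (by simp), add_comm]

theorem permPartialSum_add_sum_rest {n : ℕ} (x : Fin n → E) (k : ℕ) (τ : Equiv.Perm (Fin n)) :
    permPartialSum x k τ + ∑ i : Fin n with k ≤ i.val, x (τ i) = ∑ i, x i := by
  unfold permPartialSum
  rw [← Equiv.sum_comp τ, ← Finset.sum_filter_add_sum_filter_not Finset.univ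
    (fun i : Fin n => i.val < k)]
  simp [not_lt]

theorem sum_rest_eq_neg {n : ℕ} {x : Fin n → E} (hx : ∑ i, x i = 0) (k : ℕ)
    (τ : Equiv.Perm (Fin n)) :
    ∑ i : Fin n with k ≤ i.val, x (τ i) = - permPartialSum x k τ := by
  rw [eq_neg_iff_add_eq_zero, add_comm, permPartialSum_add_sum_rest, hx]

theorem permPartialSum_neg {n : ℕ} (x : Fin n → E) (k : ℕ) (τ : Equiv.Perm (Fin n)) :
    permPartialSum (fun i => - x i) k τ = - permPartialSum x k τ := by
  simp [permPartialSum]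

theorem permPartialSum_map {F : Type*} [AddCommGroup F] (Φ : E →+ F) {n : ℕ} (x : Fin n → E)
    (k : ℕ) (τ : Equiv.Perm (Fin n)) :
    permPartialSum (fun i => Φ (x i)) k τ = Φ (permPartialSum x k τ) := by
  simp [permPartialSum]

/-- Read backwards, an ordering starts with its last `n - k` terms, and in a centred family these
cancel the first `k`. This transfers estimates from the first half of the times to the second. -/
theorem permPartialSum_rev {n : ℕ} {x : Fin n → E} (hx : ∑ i, x i = 0) {k : ℕ} (hk : k ≤ n)
    (τ : Equiv.Perm (Fin n)) :
    permPartialSum x (n - k) (τ * Fin.revPerm) = - permPartialSum x k τ := by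
  rw [← sum_rest_eq_neg hx]
  unfold permPartialSum
  refine Finset.sum_equiv Fin.revPerm ?_ (by simp)
  intro i
  simp [Fin.val_rev]
  omega

theorem dependsOnFirst_permPartialSum {n : ℕ} (x : Fin n → E) {j k : ℕ} (hjk : j ≤ k) :
    DependsOnFirst k (permPartialSum x j) := by
  intro a b ha hb τ
  unfold permPartialSum
  refine Finset.sum_congr rfl fun i hi => ?_
  have hi' : i.val < j := by simpa using hi
  rw [Equiv.Perm.mul_apply, Equiv.swap_apply_of_ne_of_ne]
  · rintro rfl; omega
  · rintro rfl; omega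

theorem card_filter_le {n k : ℕ} (hk : k ≤ n) :
    ((Finset.univ.filter fun i : Fin n => k ≤ i.val).card : ℝ) = n - k := by
  have h1 : (Finset.univ.filter fun i : Fin n => i.val < k).card = k := by
    rw [Fin.card_filter_val_lt]; exact min_eq_right hk
  have h2 := Finset.card_filter_add_card_filter_not (s := (Finset.univ : Finset (Fin n)))
    (fun i : Fin n => i.val < k)
  simp only [not_lt, Finset.card_univ, Fintype.card_fin, h1] at h2
  rw [eq_sub_iff_add_eq']
  exact_mod_cast h2

variable {n : ℕ}

/-- Exchangeability of the places that `g` does not see. -/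
theorem sum_perm_exchange {k : ℕ} {g : Equiv.Perm (Fin n) → ℝ} (hg : DependsOnFirst k g)
    (f : Fin n → ℝ) {i j : Fin n} (hi : k ≤ i.val) (hj : k ≤ j.val) :
    ∑ τ, f (τ i) * g τ = ∑ τ, f (τ j) * g τ := by
  rw [← Equiv.sum_comp (Equiv.mulRight (Equiv.swap i j))]
  refine Finset.sum_congr rfl fun τ _ => ?_
  simp [hg i j hi hj τ]

/-- All `n - k` unseen places contribute equally. In probabilistic terms: given the first `k` draws,
a later draw is uniform on what remains. -/
theorem sum_perm_average {k : ℕ} (hk : k ≤ n) {g : Equiv.Perm (Fin n) → ℝ}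
    (hg : DependsOnFirst k g) (f : Fin n → ℝ) {j : Fin n} (hj : k ≤ j.val) :
    ((n : ℝ) - k) * ∑ τ, f (τ j) * g τ
      = ∑ τ, (∑ i : Fin n with k ≤ i.val, f (τ i)) * g τ := by
  simp_rw [Finset.sum_mul]
  rw [Finset.sum_comm, ← card_filter_le hk, ← nsmul_eq_mul, ← Finset.sum_const]
  refine Finset.sum_congr rfl fun i hi => ?_
  exact sum_perm_exchange hg f hj (by simpa using hi)

/-- `S_N / (n - N)` is a martingale in `N`, for the partial sums `S_N` of a centred family. -/
theorem sum_perm_martingale {x : Fin n → ℝ} (hx : ∑ i, x i = 0) {k N : ℕ} (hkN : k ≤ N)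
    (hN : N < n) {g : Equiv.Perm (Fin n) → ℝ} (hg : DependsOnFirst k g) :
    ∑ τ, permPartialSum x N τ * g τ
      = ((n : ℝ) - N) / (n - k) * ∑ τ, permPartialSum x k τ * g τ := by
  have hpos : (0 : ℝ) < n - k := by
    rw [sub_pos]; exact_mod_cast hkN.trans_lt hN
  induction N, hkN using Nat.le_induction with
  | base => rw [div_self hpos.ne', one_mul]
  | succ m hm ih =>
    have ih' := ih (by omega)
    have hav := sum_perm_average (j := ⟨m, by omega⟩) (by omega : k ≤ n) hg x hm
    simp_rw [sum_rest_eq_neg hx] at hav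
    simp_rw [permPartialSum_succ x (show m < n by omega), add_mul, Finset.sum_add_distrib, ih']
    -- The average is over the places unseen at time `k`, not `m`, so every new term contributes the
    -- same amount.
    have hav' : ∑ τ : Equiv.Perm (Fin n), x (τ ⟨m, by omega⟩) * g τ
        = - (∑ τ, permPartialSum x k τ * g τ) / (n - k) := by
      rw [eq_div_iff hpos.ne', mul_comm, hav, ← Finset.sum_neg_distrib]
      simp
    rw [hav']
    push_cast
    field_simp
    ring

/-- Averaging over the last draw replaces `lam` by the smaller `r * lam`, because the remaining
terms sum to minus the current partial sum. Hence `lam` is quantified inside the induction. Stopping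
at `n / 2` keeps at least `n / 2` terms undrawn, so each step costs at most `2 * lam ^ 2 * V / n` in
the exponent. -/
theorem sum_exp_permPartialSum_le {x : Fin n → ℝ} (hx : ∑ i, x i = 0) {V : ℝ}
    (hV : ∑ i, x i ^ 2 ≤ V) {k : ℕ} (hk : 2 * k ≤ n) :
    ∀ {lam : ℝ}, (∀ i, |lam * x i| ≤ 1) →
      ∑ τ, Real.exp (lam * permPartialSum x k τ)
        ≤ n ! * Real.exp (2 * lam ^ 2 * V * (k / n)) := by
  have hV0 : 0 ≤ V := (Finset.sum_nonneg fun i _ => sq_nonneg (x i)).trans hV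
  induction k with
  | zero =>
    intro lam _
    simp [permPartialSum_zero, Fintype.card_perm]
  | succ k ih =>
    intro lam hlam
    have hkn : k < n := by omega
    have hnk : (n : ℝ) / 2 ≤ n - k := by
      have : (2 * (k + 1) : ℝ) ≤ n := by exact_mod_cast hk
      linarith
    have hn : (0 : ℝ) < n := by exact_mod_cast (by omega : 0 < n)
    have hpos : (0 : ℝ) < n - k := by linarith
    have hpos1 : (1 : ℝ) ≤ n - k := by
      have : (k + 1 : ℝ) ≤ n := by exact_mod_cast hkn
      linarith
    set r : ℝ := 1 - 1 / (n - k) with hr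
    have hr0 : 0 ≤ r := by
      rw [hr, sub_nonneg, div_le_one hpos]; exact hpos1
    have hr1 : r ≤ 1 := by
      rw [hr]; linarith [one_div_pos.2 hpos]
    have hexp : ∀ i, Real.exp (lam * x i) ≤ 1 + lam * x i + lam ^ 2 * x i ^ 2 := by
      intro i
      have := (abs_le.1 (Real.abs_exp_sub_one_sub_id_le (hlam i))).2
      nlinarith
    have hav := sum_perm_average (j := ⟨k, hkn⟩) hkn.le
      (g := fun τ => Real.exp (lam * permPartialSum x k τ))
      (fun a b ha hb τ => by simp only [dependsOnFirst_permPartialSum x le_rfl a b ha hb])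
      (fun i => Real.exp (lam * x i)) le_rfl
    have hrest : ∀ τ : Equiv.Perm (Fin n),
        ∑ i : Fin n with k ≤ i.val, Real.exp (lam * x (τ i))
          ≤ (n - k) - lam * permPartialSum x k τ + lam ^ 2 * V := by
      intro τ
      calc _ ≤ ∑ i : Fin n with k ≤ i.val, (1 + lam * x (τ i) + lam ^ 2 * x (τ i) ^ 2) :=
            Finset.sum_le_sum fun i _ => hexp _
        _ = (n - k) - lam * permPartialSum x k τ
            + lam ^ 2 * ∑ i : Fin n with k ≤ i.val, x (τ i) ^ 2 := by
          rw [Finset.sum_add_distrib, Finset.sum_add_distrib, ← Finset.mul_sum,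
            ← Finset.mul_sum, sum_rest_eq_neg hx, Finset.sum_const, nsmul_eq_mul,
            card_filter_le hkn.le]
          ring
        _ ≤ _ := by
          gcongr
          calc _ ≤ ∑ i : Fin n, x (τ i) ^ 2 :=
                Finset.sum_le_sum_of_subset_of_nonneg (Finset.filter_subset _ _)
                  fun i _ _ => sq_nonneg _
            _ = ∑ i, x i ^ 2 := Equiv.sum_comp τ fun i => x i ^ 2
            _ ≤ V := hV
    have hstep : ∀ τ : Equiv.Perm (Fin n),
        (∑ i : Fin n with k ≤ i.val, Real.exp (lam * x (τ i)))
            * Real.exp (lam * permPartialSum x k τ)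
          ≤ (n - k) * (Real.exp ((r * lam) * permPartialSum x k τ)
              * Real.exp (2 * lam ^ 2 * V / n)) := by
      intro τ
      set s := permPartialSum x k τ
      have h1 : (n - k) - lam * s + lam ^ 2 * V
          ≤ (n - k) * Real.exp (-(lam * s) / (n - k) + 2 * lam ^ 2 * V / n) := by
        have h2 := Real.add_one_le_exp (-(lam * s) / (n - k) + 2 * lam ^ 2 * V / n)
        have h3 : lam ^ 2 * V / (n - k) ≤ 2 * lam ^ 2 * V / n := by
          rw [div_le_div_iff₀ hpos hn]
          nlinarith [mul_nonneg (sq_nonneg lam) hV0]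
        calc _ = (n - k) * (-(lam * s) / (n - k) + lam ^ 2 * V / (n - k) + 1) := by
              field_simp; ring
          _ ≤ _ := by gcongr; linarith
      calc _ ≤ (n - k) * Real.exp (-(lam * s) / (n - k) + 2 * lam ^ 2 * V / n)
              * Real.exp (lam * s) := by
            gcongr
            exact (hrest τ).trans h1
        _ = _ := by
          rw [mul_assoc, ← Real.exp_add, ← Real.exp_add]
          congr 2
          rw [hr]; ring
    have hmain : ((n : ℝ) - k) * ∑ τ, Real.exp (lam * permPartialSum x (k + 1) τ)
        ≤ (n - k) * ((∑ τ, Real.exp ((r * lam) * permPartialSum x k τ))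
            * Real.exp (2 * lam ^ 2 * V / n)) := by
      have : ∀ τ, Real.exp (lam * permPartialSum x (k + 1) τ)
          = Real.exp (lam * x (τ ⟨k, hkn⟩)) * Real.exp (lam * permPartialSum x k τ) := by
        intro τ
        rw [permPartialSum_succ x hkn, ← Real.exp_add]; congr 1; ring
      simp_rw [this]
      rw [hav, Finset.sum_mul, Finset.mul_sum]
      exact Finset.sum_le_sum fun τ _ => hstep τ
    refine (le_of_mul_le_mul_left hmain hpos).trans ?_
    have hlam' : ∀ i, |r * lam * x i| ≤ 1 := by
      intro i
      rw [mul_assoc, abs_mul, abs_of_nonneg hr0]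
      exact mul_le_one₀ hr1 (abs_nonneg _) (hlam i)
    refine (mul_le_mul_of_nonneg_right (ih (by omega) hlam') (Real.exp_pos _).le).trans ?_
    rw [mul_assoc, ← Real.exp_add]
    gcongr
    have : (r * lam) ^ 2 ≤ lam ^ 2 := by
      rw [mul_pow]
      exact mul_le_of_le_one_left (sq_nonneg _) (pow_le_one₀ hr0 hr1)
    calc 2 * (r * lam) ^ 2 * V * (k / n) + 2 * lam ^ 2 * V / n
        ≤ 2 * lam ^ 2 * V * (k / n) + 2 * lam ^ 2 * V / n := by gcongr
      _ = _ := by push_cast; ring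

open Classical in
/-- The maximal inequality for the first half of the partial sums. -/
theorem card_permPartialSum_half_le {x : Fin n → ℝ} (hx : ∑ i, x i = 0) {V : ℝ}
    (hV : ∑ i, x i ^ 2 ≤ V) {lam eta : ℝ} (hlam0 : 0 ≤ lam) (hlam : ∀ i, |lam * x i| ≤ 1)
    (heta : 0 ≤ eta) :
    ((Finset.univ.filter fun τ : Equiv.Perm (Fin n) =>
        ∃ k ≤ n / 2, eta < permPartialSum x k τ).card : ℝ)
      ≤ n ! * Real.exp (-(lam * eta / 2) + lam ^ 2 * V) := by
  have hV0 : 0 ≤ V := (Finset.sum_nonneg fun i _ => sq_nonneg (x i)).trans hV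
  rcases Nat.eq_zero_or_pos n with rfl | hn
  · rw [Finset.filter_false_of_mem]
    · simp; positivity
    · rintro τ - ⟨k, -, hk⟩
      simp [permPartialSum] at hk
      linarith
  set N := n / 2 with hNdef
  have hNn : N < n := by omega
  have hn' : (0 : ℝ) < n := by exact_mod_cast hn
  have hNR : (2 * N : ℝ) ≤ n := by exact_mod_cast (by omega : 2 * N ≤ n)
  -- Decomposition by the first passage above `eta`; the events are disjoint and `T k` is visible
  -- from the first `k` places.
  let T : ℕ → Finset (Equiv.Perm (Fin n)) := fun k => Finset.univ.filter fun τ =>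
    eta < permPartialSum x k τ ∧ ∀ j < k, permPartialSum x j τ ≤ eta
  have hcover : (Finset.univ.filter fun τ : Equiv.Perm (Fin n) =>
        ∃ k ≤ N, eta < permPartialSum x k τ)
      ⊆ (Finset.range (N + 1)).biUnion T := by
    intro τ hτ
    have hex : ∃ k, k ≤ N ∧ eta < permPartialSum x k τ := by simpa using hτ
    have hs := Nat.find_spec hex
    simp only [Finset.mem_biUnion, Finset.mem_range, T, Finset.mem_filter, Finset.mem_univ,
      true_and]
    refine ⟨Nat.find hex, by omega, hs.2, fun j hj => ?_⟩
    have hmin := Nat.find_min hex hj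
    push Not at hmin
    exact hmin (by omega)
  have hdisj : ∀ i ∈ Finset.range (N + 1), ∀ j ∈ Finset.range (N + 1), i ≠ j →
      Disjoint (T i) (T j) := by
    intro i _ j _ hij
    rw [Finset.disjoint_left]
    intro τ h1 h2
    simp only [T, Finset.mem_filter, Finset.mem_univ, true_and] at h1 h2
    rcases lt_or_gt_of_ne hij with h | h
    · exact absurd h1.1 (not_lt.2 (h2.2 i h))
    · exact absurd h2.1 (not_lt.2 (h1.2 j h))
  have hone : ∀ k ∈ Finset.range (N + 1), ((T k).card : ℝ) * Real.exp (lam * eta / 2)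
      ≤ ∑ τ ∈ T k, Real.exp (lam * permPartialSum x N τ) := by
    intro k hk
    have hkN : k ≤ N := by simpa [Nat.lt_succ_iff] using hk
    have hpos : (0 : ℝ) < n - k := by
      rw [sub_pos]; exact_mod_cast hkN.trans_lt hNn
    -- The conditional mean of the sum at `N`, given the first `k` places, is `r` times the sum at
    -- `k`. Since `N ≤ n / 2`, at least half of an excess survives on average.
    set r : ℝ := ((n : ℝ) - N) / (n - k) with hr
    have hr2 : 1 / 2 ≤ r := by
      rw [hr, div_le_div_iff₀ (by norm_num) hpos]
      have : (0 : ℝ) ≤ k := by positivity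
      linarith
    let g : Equiv.Perm (Fin n) → ℝ := fun τ =>
      (if τ ∈ T k then 1 else 0) * Real.exp (lam * r * permPartialSum x k τ)
    have hinv : ∀ j ≤ k, DependsOnFirst k (permPartialSum x j) := fun j hj =>
      dependsOnFirst_permPartialSum x hj
    have hgdep : DependsOnFirst k g := by
      intro a b ha hb τ
      have hT : (τ * Equiv.swap a b ∈ T k) ↔ τ ∈ T k := by
        simp only [T, Finset.mem_filter, Finset.mem_univ, true_and, hinv k le_rfl a b ha hb]
        refine and_congr_right fun _ => forall₂_congr fun j hj => ?_
        rw [hinv j hj.le a b ha hb]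
      simp only [g, hT, hinv k le_rfl a b ha hb]
    have hmart := sum_perm_martingale hx hkN hNn hgdep
    rw [← hr] at hmart
    -- This vanishing linear term, with `1 + u ≤ exp u`, takes the place of conditional Jensen.
    have hzero : ∑ τ, (lam * (permPartialSum x N τ - r * permPartialSum x k τ)) * g τ = 0 := by
      have : ∀ τ, (lam * (permPartialSum x N τ - r * permPartialSum x k τ)) * g τ
          = lam * (permPartialSum x N τ * g τ - r * (permPartialSum x k τ * g τ)) := by
        intro τ; ring
      simp_rw [this]
      rw [← Finset.mul_sum, Finset.sum_sub_distrib, ← Finset.mul_sum, hmart, sub_self, mul_zero]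
    calc ((T k).card : ℝ) * Real.exp (lam * eta / 2)
        = ∑ τ ∈ T k, Real.exp (lam * eta / 2) := by rw [Finset.sum_const, nsmul_eq_mul]
      _ ≤ ∑ τ ∈ T k, Real.exp (lam * r * permPartialSum x k τ) := by
        refine Finset.sum_le_sum fun τ hτ => Real.exp_le_exp.2 ?_
        simp only [T, Finset.mem_filter, Finset.mem_univ, true_and] at hτ
        have : 1 / 2 * eta ≤ r * permPartialSum x k τ :=
          mul_le_mul hr2 hτ.1.le heta (by linarith)
        nlinarith
      _ = ∑ τ, g τ := by simp [g]
      _ = ∑ τ, (1 + lam * (permPartialSum x N τ - r * permPartialSum x k τ)) * g τ := by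
        simp_rw [add_mul, one_mul, Finset.sum_add_distrib, hzero, add_zero]
      _ ≤ ∑ τ, (if τ ∈ T k then 1 else 0) * Real.exp (lam * permPartialSum x N τ) := by
        refine Finset.sum_le_sum fun τ _ => ?_
        by_cases hτ : τ ∈ T k
        · simp only [g, hτ, if_true, one_mul]
          have h1 := Real.add_one_le_exp
            (lam * (permPartialSum x N τ - r * permPartialSum x k τ))
          calc _ ≤ Real.exp (lam * (permPartialSum x N τ - r * permPartialSum x k τ))
                * Real.exp (lam * r * permPartialSum x k τ) := by
                gcongr; linarith
            _ = _ := by rw [← Real.exp_add]; congr 1; ring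
        · simp [g, hτ]
      _ = _ := by simp
  have hsum : ((Finset.univ.filter fun τ : Equiv.Perm (Fin n) =>
        ∃ k ≤ N, eta < permPartialSum x k τ).card : ℝ) * Real.exp (lam * eta / 2)
      ≤ n ! * Real.exp (lam ^ 2 * V) := by
    calc _ ≤ (((Finset.range (N + 1)).biUnion T).card : ℝ) * Real.exp (lam * eta / 2) := by
          gcongr
      _ = ∑ k ∈ Finset.range (N + 1), ((T k).card : ℝ) * Real.exp (lam * eta / 2) := by
        rw [Finset.card_biUnion hdisj, Nat.cast_sum, Finset.sum_mul]
      _ ≤ ∑ k ∈ Finset.range (N + 1), ∑ τ ∈ T k, Real.exp (lam * permPartialSum x N τ) :=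
        Finset.sum_le_sum hone
      _ = ∑ τ ∈ (Finset.range (N + 1)).biUnion T, Real.exp (lam * permPartialSum x N τ) :=
        (Finset.sum_biUnion hdisj).symm
      _ ≤ ∑ τ, Real.exp (lam * permPartialSum x N τ) :=
        Finset.sum_le_sum_of_subset_of_nonneg (Finset.subset_univ _)
          fun _ _ _ => (Real.exp_pos _).le
      _ ≤ n ! * Real.exp (2 * lam ^ 2 * V * (N / n)) :=
        sum_exp_permPartialSum_le hx hV (by omega) hlam
      _ ≤ _ := by
        refine mul_le_mul_of_nonneg_left (Real.exp_le_exp.2 ?_) (Nat.cast_nonneg _)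
        have : (N / n : ℝ) ≤ 1 / 2 := by
          rw [div_le_div_iff₀ hn' (by norm_num)]; linarith
        nlinarith [mul_nonneg (sq_nonneg lam) hV0]
  rw [Real.exp_add, Real.exp_neg]
  have hp := Real.exp_pos (lam * eta / 2)
  calc _ ≤ n ! * Real.exp (lam ^ 2 * V) / Real.exp (lam * eta / 2) := (le_div_iff₀ hp).2 hsum
    _ = _ := by field_simp

open Classical in
/-- The two-sided maximal inequality for all partial sums of a randomly ordered family. -/
theorem card_abs_permPartialSum_le {x : Fin n → ℝ} (hx : ∑ i, x i = 0) {V : ℝ}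
    (hV : ∑ i, x i ^ 2 ≤ V) {lam eta : ℝ} (hlam0 : 0 ≤ lam) (hlam : ∀ i, |lam * x i| ≤ 1)
    (heta : 0 ≤ eta) :
    ((Finset.univ.filter fun τ : Equiv.Perm (Fin n) =>
        ∃ k ≤ n, eta < |permPartialSum x k τ|).card : ℝ)
      ≤ 4 * (n ! * Real.exp (-(lam * eta / 2) + lam ^ 2 * V)) := by
  let x' : Fin n → ℝ := fun i => - x i
  have hx' : ∑ i, x' i = 0 := by simp [x', hx]
  have hV' : ∑ i, x' i ^ 2 ≤ V := by simpa [x'] using hV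
  have hlam' : ∀ i, |lam * x' i| ≤ 1 := by simpa [x', abs_mul] using hlam
  let B : (Fin n → ℝ) → Finset (Equiv.Perm (Fin n)) := fun y =>
    Finset.univ.filter fun τ => ∃ k ≤ n / 2, eta < permPartialSum y k τ
  let ρ : Equiv.Perm (Fin n) ≃ Equiv.Perm (Fin n) := Equiv.mulRight Fin.revPerm
  have h1 : ((B x).card : ℝ) ≤ _ := card_permPartialSum_half_le hx hV hlam0 hlam heta
  have h2 : ((B x').card : ℝ) ≤ _ := card_permPartialSum_half_le hx' hV' hlam0 hlam' heta
  have hsub : (Finset.univ.filter fun τ : Equiv.Perm (Fin n) =>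
        ∃ k ≤ n, eta < |permPartialSum x k τ|)
      -- Two signs and two halves of the time range account for the factor `4`.
      ⊆ (B x ∪ B x') ∪ ((B x).map ρ.symm.toEmbedding ∪ (B x').map ρ.symm.toEmbedding) := by
    intro τ hτ
    obtain ⟨k, hk, hlt⟩ : ∃ k ≤ n, eta < |permPartialSum x k τ| := by simpa using hτ
    simp only [Finset.mem_union, Finset.mem_map_equiv, Equiv.symm_symm]
    rcases le_or_gt k (n / 2) with hk2 | hk2
    · left
      rcases lt_abs.1 hlt with h | h
      · left; simp only [B, Finset.mem_filter, Finset.mem_univ, true_and]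
        exact ⟨k, hk2, h⟩
      · right; simp only [B, Finset.mem_filter, Finset.mem_univ, true_and]
        exact ⟨k, hk2, by rwa [permPartialSum_neg]⟩
    · right
      have hrev : permPartialSum x (n - k) (ρ τ) = - permPartialSum x k τ :=
        permPartialSum_rev hx hk τ
      rcases lt_abs.1 hlt with h | h
      · right; simp only [B, Finset.mem_filter, Finset.mem_univ, true_and]
        exact ⟨n - k, by omega, by rwa [permPartialSum_neg, hrev, neg_neg]⟩
      · left; simp only [B, Finset.mem_filter, Finset.mem_univ, true_and]
        exact ⟨n - k, by omega, by rwa [hrev]⟩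
  have hcard := (Finset.card_le_card hsub).trans ((Finset.card_union_le _ _).trans
    (add_le_add (Finset.card_union_le _ _) (Finset.card_union_le _ _)))
  simp only [Finset.card_map] at hcard
  have hcard' : ((Finset.univ.filter fun τ : Equiv.Perm (Fin n) =>
      ∃ k ≤ n, eta < |permPartialSum x k τ|).card : ℝ)
      ≤ ((B x).card + (B x').card) + ((B x).card + (B x').card) := by exact_mod_cast hcard
  linarith

open Classical in
/-- The maximal inequality in a finite-dimensional space, in coordinates. -/
theorem card_norm_permPartialSum_le {F : Type*} [NormedAddCommGroup F] [NormedSpace ℝ F]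
    {m : ℕ} (Φ : F ≃L[ℝ] (Fin m → ℝ)) {K : ℝ} (hK : 0 < K)
    (hΦ : ∀ v, ‖Φ v‖ ≤ K * ‖v‖) (hΦ' : ∀ w, ‖Φ.symm w‖ ≤ K * ‖w‖)
    {y : Fin n → F} (hy : ∑ i, y i = 0) {b V : ℝ} (hb : ∀ i, ‖y i‖ ≤ b)
    (hV : ∑ i, ‖y i‖ ^ 2 ≤ V) {Lam eta : ℝ} (hLam : 0 ≤ Lam) (heta : 0 < eta)
    (h1 : Lam * (K ^ 2 * b) ≤ eta) (h2 : Lam * (4 * K ^ 4 * V) ≤ eta ^ 2) :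
    ((Finset.univ.filter fun τ : Equiv.Perm (Fin n) =>
        ∃ k ≤ n, eta < ‖permPartialSum y k τ‖).card : ℝ)
      ≤ 4 * m * n ! * Real.exp (- (Lam / 4)) := by
  set e := eta / K with he
  have he0 : 0 < e := div_pos heta hK
  have hcoord : ∀ v l, |Φ v l| ≤ K * ‖v‖ := fun v l =>
    (norm_le_pi_norm (Φ v) l).trans (hΦ v)
  let B : Fin m → Finset (Equiv.Perm (Fin n)) := fun l => Finset.univ.filter fun τ =>
    ∃ k ≤ n, e < |permPartialSum (fun i => Φ (y i) l) k τ|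
  have hB : ∀ l, ((B l).card : ℝ) ≤ 4 * (n ! * Real.exp (- (Lam / 4))) := by
    intro l
    have hsum : ∑ i, Φ (y i) l = 0 := by
      rw [← Finset.sum_apply, ← map_sum, hy]; simp
    have hsq : ∑ i, (Φ (y i) l) ^ 2 ≤ K ^ 2 * V := by
      calc _ ≤ ∑ i, K ^ 2 * ‖y i‖ ^ 2 := by
            refine Finset.sum_le_sum fun i _ => ?_
            rw [← mul_pow, ← sq_abs]
            exact pow_le_pow_left₀ (abs_nonneg _) (hcoord _ _) 2
        _ ≤ _ := by rw [← Finset.mul_sum]; gcongr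
    have hlam : ∀ i, |Lam / e * Φ (y i) l| ≤ 1 := by
      intro i
      rw [abs_mul, abs_of_nonneg (by positivity), div_mul_eq_mul_div, div_le_one he0, he,
        le_div_iff₀ hK]
      calc Lam * |Φ (y i) l| * K ≤ Lam * (K * b) * K := by
            gcongr
            exact (hcoord _ _).trans (by gcongr; exact hb i)
        _ ≤ eta := by linarith [h1, show Lam * (K * b) * K = Lam * (K ^ 2 * b) by ring]
    -- With parameter `Lam / e` the linear term is `-Lam / 2`, and `h2` caps the quadratic one at
    -- `Lam / 4`.
    refine (card_abs_permPartialSum_le hsum hsq (by positivity) hlam he0.le).trans ?_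
    gcongr
    have hq : Lam * (4 * (K ^ 2 * V)) ≤ e ^ 2 := by
      rw [he, div_pow, le_div_iff₀ (by positivity)]
      linarith [show Lam * (4 * (K ^ 2 * V)) * K ^ 2 = Lam * (4 * K ^ 4 * V) by ring]
    have hq' : (Lam / e) ^ 2 * (K ^ 2 * V) ≤ Lam / 4 := by
      rw [div_pow, div_mul_eq_mul_div, div_le_iff₀ (by positivity)]
      nlinarith
    have : Lam / e * e / 2 = Lam / 2 := by field_simp
    rw [this]
    linarith
  have hsub : (Finset.univ.filter fun τ : Equiv.Perm (Fin n) =>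
      ∃ k ≤ n, eta < ‖permPartialSum y k τ‖) ⊆ Finset.univ.biUnion B := by
    intro τ hτ
    obtain ⟨k, hk, hlt⟩ : ∃ k ≤ n, eta < ‖permPartialSum y k τ‖ := by simpa using hτ
    by_contra hcon
    simp only [Finset.mem_biUnion, Finset.mem_univ, true_and, B, Finset.mem_filter,
      not_exists, not_and, not_lt] at hcon
    have hle : ‖Φ (permPartialSum y k τ)‖ ≤ e := by
      rw [pi_norm_le_iff_of_nonneg he0.le]
      intro l
      have h := hcon l k hk
      have hmap := permPartialSum_map (AddMonoidHom.mk' (fun v => Φ v l) (by simp)) y k τ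
      simp only [AddMonoidHom.mk'_apply] at hmap
      rwa [hmap] at h
    have := hΦ' (Φ (permPartialSum y k τ))
    rw [ContinuousLinearEquiv.symm_apply_apply] at this
    have h3 : K * ‖Φ (permPartialSum y k τ)‖ ≤ K * e := by gcongr
    have h4 : K * e = eta := by rw [he]; field_simp
    linarith
  calc _ ≤ ((Finset.univ.biUnion B).card : ℝ) := by exact_mod_cast Finset.card_le_card hsub
    _ ≤ ∑ l, ((B l).card : ℝ) := by exact_mod_cast Finset.card_biUnion_le
    _ ≤ ∑ l : Fin m, 4 * (n ! * Real.exp (- (Lam / 4))) := Finset.sum_le_sum fun l _ => hB l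
    _ = _ := by simp; ring

end PermutationSums

/-! ### Deterministic comparison of a product of exponentials with a single exponential. -/

section ExpProducts

variable {R : Type*} [NormedRing R] [NormedAlgebra ℝ R]

theorem norm_inv_factorial_smul_pow_le [NormOneClass R] (x : R) (k : ℕ) :
    ‖((k ! : ℝ)⁻¹) • x ^ k‖ ≤ (k ! : ℝ)⁻¹ * ‖x‖ ^ k := by
  rw [norm_smul, Real.norm_of_nonneg (by positivity)]
  gcongr
  exact norm_pow_le x k

theorem hasSum_real_exp (c : ℝ) : HasSum (fun k : ℕ => (k ! : ℝ)⁻¹ * c ^ k) (Real.exp c) := by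
  have := NormedSpace.exp_series_hasSum_exp' (𝕂 := ℝ) c
  rw [← Real.exp_eq_exp_ℝ] at this
  simpa using this

variable [CompleteSpace R]

theorem exp_add_smul (D : R) (s t : ℝ) :
    NormedSpace.exp ((s + t) • D) = NormedSpace.exp (s • D) * NormedSpace.exp (t • D) := by
  let : NormedAlgebra ℚ R := NormedAlgebra.restrictScalars ℚ ℝ R
  rw [add_smul, NormedSpace.exp_add_of_commute]
  exact ((Commute.refl D).smul_left s).smul_right t

variable [NormOneClass R]

theorem norm_exp_sub_partial_le (x : R) (m : ℕ) :
    ‖NormedSpace.exp x - ∑ k ∈ Finset.range m, ((k ! : ℝ)⁻¹) • x ^ k‖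
      ≤ Real.exp ‖x‖ - ∑ k ∈ Finset.range m, (k ! : ℝ)⁻¹ * ‖x‖ ^ k := by
  have h1 := (hasSum_nat_add_iff' m).2 (NormedSpace.exp_series_hasSum_exp' (𝕂 := ℝ) x)
  have h2 := (hasSum_nat_add_iff' m).2 (hasSum_real_exp ‖x‖)
  rw [← h1.tsum_eq]
  exact tsum_of_norm_bounded h2 fun k => norm_inv_factorial_smul_pow_le x (k + m)

theorem norm_normedSpace_exp_le (x : R) : ‖NormedSpace.exp x‖ ≤ Real.exp ‖x‖ := by
  simpa using norm_exp_sub_partial_le x 0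

theorem norm_normedSpace_exp_sub_one_le (x : R) :
    ‖NormedSpace.exp x - 1‖ ≤ Real.exp ‖x‖ - 1 := by
  simpa using norm_exp_sub_partial_le x 1

theorem norm_normedSpace_exp_sub_one_sub_id_le (x : R) :
    ‖NormedSpace.exp x - 1 - x‖ ≤ ‖x‖ ^ 2 * Real.exp ‖x‖ := by
  have h : ‖NormedSpace.exp x - 1 - x‖ ≤ Real.exp ‖x‖ - 1 - ‖x‖ := by
    simpa [Finset.sum_range_succ, sub_sub] using norm_exp_sub_partial_le x 2
  refine h.trans ?_
  set c := ‖x‖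
  have hc : 0 ≤ c := norm_nonneg x
  have h1 : Real.exp c - 1 ≤ c * Real.exp c := by
    have h2 := mul_le_mul_of_nonneg_right (Real.add_one_le_exp (-c)) (Real.exp_pos c).le
    rw [← Real.exp_add, neg_add_cancel, Real.exp_zero] at h2
    linarith
  nlinarith

variable {P C : ℕ → R} {n : ℕ}

theorem norm_expProd_le (hP0 : P 0 = 1)
    (hP : ∀ k < n, P (k + 1) = P k * NormedSpace.exp (C k)) {k : ℕ} (hk : k ≤ n) :
    ‖P k‖ ≤ Real.exp (∑ j ∈ Finset.range k, ‖C j‖) := by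
  induction k with
  | zero => simp [hP0]
  | succ k ih =>
    rw [hP k hk, Finset.sum_range_succ, Real.exp_add]
    exact (norm_mul_le _ _).trans (mul_le_mul (ih (by omega)) (norm_normedSpace_exp_le _)
      (norm_nonneg _) (Real.exp_pos _).le)

/-- The bound is an increment of a scalar sequence, so the total variation of `P` telescopes and
costs only one exponential of the summed norms, with no extra polynomial factor. -/
theorem norm_expProd_succ_sub_le (hP0 : P 0 = 1)
    (hP : ∀ k < n, P (k + 1) = P k * NormedSpace.exp (C k)) {k : ℕ} (hk : k < n) :
    ‖P (k + 1) - P k‖ ≤ Real.exp (∑ j ∈ Finset.range (k + 1), ‖C j‖)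
      - Real.exp (∑ j ∈ Finset.range k, ‖C j‖) := by
  have h : P (k + 1) - P k = P k * (NormedSpace.exp (C k) - 1) := by
    rw [hP k hk, mul_sub, mul_one]
  rw [h, Finset.sum_range_succ, Real.exp_add]
  calc _ ≤ ‖P k‖ * ‖NormedSpace.exp (C k) - 1‖ := norm_mul_le _ _
    _ ≤ Real.exp (∑ j ∈ Finset.range k, ‖C j‖) * (Real.exp ‖C k‖ - 1) :=
      mul_le_mul (norm_expProd_le hP0 hP hk.le) (norm_normedSpace_exp_sub_one_le _)
        (norm_nonneg _) (Real.exp_pos _).le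
    _ = _ := by ring

theorem norm_expProd_sub_one_le (hP0 : P 0 = 1)
    (hP : ∀ k < n, P (k + 1) = P k * NormedSpace.exp (C k)) {k : ℕ} (hk : k ≤ n) :
    ‖P k - 1‖ ≤ Real.exp (∑ j ∈ Finset.range k, ‖C j‖) - 1 := by
  induction k with
  | zero => simp [hP0]
  | succ k ih =>
    calc ‖P (k + 1) - 1‖ = ‖(P (k + 1) - P k) + (P k - 1)‖ := by rw [sub_add_sub_cancel]
      _ ≤ _ := norm_add_le _ _
      _ ≤ _ := add_le_add (norm_expProd_succ_sub_le hP0 hP hk) (ih (by omega))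
      _ = _ := by ring

/-- Summation by parts: a product of exponentials is close to `exp (k D)` as soon as the partial
sums of the exponents are uniformly close to `k D`. -/
theorem norm_expProd_sub_exp_le (hP0 : P 0 = 1)
    (hP : ∀ k < n, P (k + 1) = P k * NormedSpace.exp (C k)) (D : R) {eta : ℝ}
    (heta : ∀ k ≤ n, ‖∑ j ∈ Finset.range k, (C j - D)‖ ≤ eta) {k : ℕ} (hk : k ≤ n) :
    ‖P k - NormedSpace.exp ((k : ℝ) • D)‖
      ≤ Real.exp (∑ j ∈ Finset.range n, ‖C j‖) * Real.exp (n * ‖D‖) ^ 2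
        * (3 * eta + (∑ j ∈ Finset.range n, ‖C j‖ ^ 2 + n * (‖D‖ ^ 2 * Real.exp ‖D‖))) := by
  set L := ∑ j ∈ Finset.range n, ‖C j‖ with hL
  set d := ‖D‖ with hd
  have hd0 : 0 ≤ d := norm_nonneg D
  have heta0 : 0 ≤ eta := (norm_nonneg _).trans (heta 0 (Nat.zero_le _))
  let p : ℕ → ℝ := fun k => Real.exp (∑ j ∈ Finset.range k, ‖C j‖)
  -- `P k * W k` should stay near `1`; its increments are `P k * (C k - D + rem k) * W (k + 1)`.
  let W : ℕ → R := fun k => NormedSpace.exp ((-(k : ℝ)) • D)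
  let S : ℕ → R := fun k => ∑ j ∈ Finset.range k, (C j - D)
  have hpL : ∀ k ≤ n, p k ≤ Real.exp L := fun k hk => Real.exp_le_exp.2
    (Finset.sum_le_sum_of_subset_of_nonneg (Finset.range_mono hk) fun _ _ _ => norm_nonneg _)
  have hW : ∀ k, W k = NormedSpace.exp D * W (k + 1) := by
    intro k
    have := exp_add_smul D 1 (-((k + 1 : ℕ) : ℝ))
    rw [one_smul] at this
    simp only [W]
    rw [← this]; congr 2; push_cast; ring
  have hWn : ∀ k ≤ n, ‖W k‖ ≤ Real.exp (n * d) := by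
    intro k hk
    refine (norm_normedSpace_exp_le _).trans (Real.exp_le_exp.2 ?_)
    rw [norm_smul, norm_neg, Real.norm_natCast]
    gcongr
  have hWd : ∀ k, ‖W (k + 1) - W k‖ ≤ Real.exp ((k + 1 : ℕ) * d) - Real.exp (k * d) := by
    intro k
    have h1 : W (k + 1) - W k = W k * (NormedSpace.exp ((-1 : ℝ) • D) - 1) := by
      rw [mul_sub, mul_one]
      simp only [W]
      rw [← exp_add_smul]; congr 3; push_cast; ring
    have h2 : ‖W k‖ ≤ Real.exp (k * d) := by
      refine (norm_normedSpace_exp_le _).trans (Real.exp_le_exp.2 ?_)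
      rw [norm_smul, norm_neg, Real.norm_natCast]
    have h3 : ‖NormedSpace.exp ((-1 : ℝ) • D) - 1‖ ≤ Real.exp d - 1 := by
      simpa using norm_normedSpace_exp_sub_one_le ((-1 : ℝ) • D)
    rw [h1]
    calc _ ≤ Real.exp (k * d) * (Real.exp d - 1) := (norm_mul_le _ _).trans
          (mul_le_mul h2 h3 (norm_nonneg _) (Real.exp_pos _).le)
      _ = _ := by rw [mul_sub, ← Real.exp_add]; congr 2 <;> push_cast <;> ring
  let rem : ℕ → R := fun k =>
    (NormedSpace.exp (C k) - 1 - C k) - (NormedSpace.exp D - 1 - D)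
  have hrem : ∀ k < n, ‖P k * rem k‖
      ≤ Real.exp L * (‖C k‖ ^ 2 + d ^ 2 * Real.exp d) := by
    intro k hk
    have h1 : ‖rem k‖ ≤ ‖C k‖ ^ 2 * Real.exp ‖C k‖ + d ^ 2 * Real.exp d :=
      (norm_sub_le _ _).trans (add_le_add (norm_normedSpace_exp_sub_one_sub_id_le _)
        (norm_normedSpace_exp_sub_one_sub_id_le _))
    -- The exponential in the Taylor remainder is absorbed as the next factor of `p`.
    have h2 : p k * Real.exp ‖C k‖ ≤ Real.exp L := by
      refine le_trans (le_of_eq ?_) (hpL (k + 1) hk)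
      simp only [p]
      rw [Finset.sum_range_succ, Real.exp_add]
    calc _ ≤ p k * (‖C k‖ ^ 2 * Real.exp ‖C k‖ + d ^ 2 * Real.exp d) :=
          (norm_mul_le _ _).trans (mul_le_mul (norm_expProd_le hP0 hP hk.le) h1
            (norm_nonneg _) (Real.exp_pos _).le)
      _ = (p k * Real.exp ‖C k‖) * ‖C k‖ ^ 2 + p k * (d ^ 2 * Real.exp d) := by ring
      _ ≤ Real.exp L * ‖C k‖ ^ 2 + Real.exp L * (d ^ 2 * Real.exp d) := by
        gcongr
        exact hpL k hk.le
      _ = _ := by ring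
  -- Abel summation: with the boundary term `P k * S k * W k` removed, the variation of `P`, the
  -- variation of `W` and the quadratic remainders are left. The boundary and the two variations
  -- give the `3 * eta`.
  have hZ : ∀ k ≤ n, ‖P k * W k - 1 - P k * S k * W k‖
      ≤ eta * Real.exp (n * d) * p k + Real.exp L * eta * Real.exp (k * d)
        + Real.exp L * Real.exp (n * d)
          * ∑ j ∈ Finset.range k, (‖C j‖ ^ 2 + d ^ 2 * Real.exp d) := by
    intro k
    induction k with
    | zero =>
      intro _
      simp [hP0, W, S, p]
      positivity
    | succ k ih =>
      intro hk
      have hk' : k ≤ n := by omega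
      have hS : S (k + 1) = S k + (C k - D) := Finset.sum_range_succ _ _
      have hid : P (k + 1) * W (k + 1) - 1 - P (k + 1) * S (k + 1) * W (k + 1)
          = (P k * W k - 1 - P k * S k * W k)
            + (-((P (k + 1) - P k) * S (k + 1) * W (k + 1))
              + (-(P k * S k * (W (k + 1) - W k)) + P k * rem k * W (k + 1))) := by
        have e1 : P (k + 1) * W (k + 1) = P k * NormedSpace.exp (C k) * W (k + 1) := by
          rw [hP k hk]
        have e2 : P k * W k = P k * NormedSpace.exp D * W (k + 1) := by
          rw [hW k, mul_assoc]
        rw [e1, e2, hS]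
        simp only [rem]
        noncomm_ring
      have b1 : ‖(P (k + 1) - P k) * S (k + 1) * W (k + 1)‖
          ≤ (p (k + 1) - p k) * eta * Real.exp (n * d) :=
        (norm_mul_le _ _).trans (mul_le_mul ((norm_mul_le _ _).trans (mul_le_mul
          (norm_expProd_succ_sub_le hP0 hP hk) (heta _ hk) (norm_nonneg _)
          ((norm_nonneg _).trans (norm_expProd_succ_sub_le hP0 hP hk)))) (hWn _ hk)
          (norm_nonneg _) (mul_nonneg ((norm_nonneg _).trans
            (norm_expProd_succ_sub_le hP0 hP hk)) heta0))
      have b2 : ‖P k * S k * (W (k + 1) - W k)‖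
          ≤ Real.exp L * eta * (Real.exp ((k + 1 : ℕ) * d) - Real.exp (k * d)) :=
        (norm_mul_le _ _).trans (mul_le_mul ((norm_mul_le _ _).trans (mul_le_mul
          ((norm_expProd_le hP0 hP hk').trans (hpL k hk')) (heta _ hk') (norm_nonneg _)
          (Real.exp_pos _).le)) (hWd k) (norm_nonneg _) (by positivity))
      have b3 : ‖P k * rem k * W (k + 1)‖
          ≤ Real.exp L * (‖C k‖ ^ 2 + d ^ 2 * Real.exp d) * Real.exp (n * d) :=
        (norm_mul_le _ _).trans (mul_le_mul (hrem k hk) (hWn _ hk) (norm_nonneg _)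
          (by positivity))
      rw [hid, Finset.sum_range_succ]
      refine (norm_add_le _ _).trans ((add_le_add (ih hk') ((norm_add_le _ _).trans
        (add_le_add (le_of_eq (norm_neg _)) ((norm_add_le _ _).trans
          (add_le_add (le_of_eq (norm_neg _)) le_rfl))))).trans ?_)
      linarith
  have hkd : Real.exp (k * d) ≤ Real.exp (n * d) := by
    apply Real.exp_le_exp.2; gcongr
  have hsum : ∑ j ∈ Finset.range k, (‖C j‖ ^ 2 + d ^ 2 * Real.exp d)
      ≤ ∑ j ∈ Finset.range n, ‖C j‖ ^ 2 + n * (d ^ 2 * Real.exp d) := by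
    calc _ ≤ ∑ j ∈ Finset.range n, (‖C j‖ ^ 2 + d ^ 2 * Real.exp d) :=
          Finset.sum_le_sum_of_subset_of_nonneg (Finset.range_mono hk) fun _ _ _ => by positivity
      _ = _ := by rw [Finset.sum_add_distrib]; simp
  have hPSW : ‖P k * S k * W k‖ ≤ Real.exp L * eta * Real.exp (n * d) :=
    (norm_mul_le _ _).trans (mul_le_mul ((norm_mul_le _ _).trans (mul_le_mul
      ((norm_expProd_le hP0 hP hk).trans (hpL k hk)) (heta _ hk) (norm_nonneg _)
      (Real.exp_pos _).le)) (hWn k hk) (norm_nonneg _) (by positivity))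
  have hmain : ‖P k * W k - 1‖ ≤ Real.exp L * Real.exp (n * d)
      * (3 * eta + (∑ j ∈ Finset.range n, ‖C j‖ ^ 2 + n * (d ^ 2 * Real.exp d))) := by
    calc ‖P k * W k - 1‖ = ‖(P k * W k - 1 - P k * S k * W k) + P k * S k * W k‖ := by
          rw [sub_add_cancel]
      _ ≤ _ := norm_add_le _ _
      _ ≤ (eta * Real.exp (n * d) * Real.exp L + Real.exp L * eta * Real.exp (n * d)
        + Real.exp L * Real.exp (n * d)
          * (∑ j ∈ Finset.range n, ‖C j‖ ^ 2 + n * (d ^ 2 * Real.exp d)))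
          + Real.exp L * eta * Real.exp (n * d) := by
        refine add_le_add ((hZ k hk).trans ?_) hPSW
        gcongr
        exact hpL k hk
      _ = _ := by ring
  have hinv : W k * NormedSpace.exp ((k : ℝ) • D) = 1 := by
    simp only [W]
    rw [← exp_add_smul]; simp
  have hfin : P k - NormedSpace.exp ((k : ℝ) • D)
      = (P k * W k - 1) * NormedSpace.exp ((k : ℝ) • D) := by
    rw [sub_mul, mul_assoc, hinv, mul_one, one_mul]
  have hE : ‖NormedSpace.exp ((k : ℝ) • D)‖ ≤ Real.exp (n * d) := by
    refine (norm_normedSpace_exp_le _).trans (le_trans ?_ hkd)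
    rw [norm_smul, Real.norm_natCast]
  rw [hfin]
  refine (norm_mul_le _ _).trans ((mul_le_mul hmain hE (norm_nonneg _)
    ((norm_nonneg _).trans hmain)).trans (le_of_eq ?_))
  ring

end ExpProducts

/-! ### Norm estimates for a row of the array. -/

namespace TriArray

variable {d : ℕ} (X : TriArray d) {n : ℕ}

/-- The ordered product of the first `k` of the factors `exp (X n (τ i) / n)`. -/
noncomputable def prefixProd (n : ℕ) (τ : Equiv.Perm (Fin n)) (k : ℕ) : CMat d :=
  ((List.ofFn fun i : Fin n => NormedSpace.exp ((n : ℝ)⁻¹ • X n (τ i))).take k).prod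

/-- The centred and rescaled entries of row `n`. -/
noncomputable def centred (n : ℕ) (i : Fin n) : CMat d :=
  (n : ℝ)⁻¹ • X n i - (n : ℝ)⁻¹ • X.rowAvg n

theorem permProd_eq_prefixProd (τ : Equiv.Perm (Fin n)) (t : ℝ) :
    X.permProd n τ t = X.prefixProd n τ ⌊t * n⌋₊ := rfl

theorem prefixProd_zero (τ : Equiv.Perm (Fin n)) : X.prefixProd n τ 0 = 1 := by
  simp [prefixProd]

theorem prefixProd_succ (τ : Equiv.Perm (Fin n)) {k : ℕ} (hk : k < n) :
    X.prefixProd n τ (k + 1)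
      = X.prefixProd n τ k * NormedSpace.exp ((n : ℝ)⁻¹ • X n (τ ⟨k, hk⟩)) := by
  unfold prefixProd
  rw [List.prod_take_succ _ _ (by simpa using hk)]
  simp

theorem normMax_nonneg (n : ℕ) : 0 ≤ X.normMax n := Real.iSup_nonneg fun _ => norm_nonneg _

theorem normAvg_nonneg (n : ℕ) : 0 ≤ X.normAvg n := by
  unfold normAvg; positivity

theorem norm_le_normMax (i : Fin n) : ‖X n i‖ ≤ X.normMax n :=
  le_ciSup (f := fun i => ‖X n i‖) (Set.finite_range _).bddAbove i

theorem norm_rowAvg_le_normAvg (n : ℕ) : ‖X.rowAvg n‖ ≤ X.normAvg n := by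
  unfold rowAvg normAvg
  rw [norm_smul, norm_inv, Real.norm_natCast]
  gcongr
  exact norm_sum_le _ _

theorem normAvg_le_normMax (n : ℕ) : X.normAvg n ≤ X.normMax n := by
  rcases Nat.eq_zero_or_pos n with rfl | hn
  · simpa [normAvg] using X.normMax_nonneg 0
  · have hn' : (0 : ℝ) < n := by exact_mod_cast hn
    unfold normAvg
    rw [inv_mul_le_iff₀ hn']
    calc _ ≤ ∑ _i : Fin n, X.normMax n := Finset.sum_le_sum fun i _ => X.norm_le_normMax i
      _ = _ := by simp

theorem sum_norm_eq (hn : 0 < n) : ∑ i : Fin n, ‖X n i‖ = n * X.normAvg n := by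
  have hn' : (n : ℝ) ≠ 0 := by exact_mod_cast hn.ne'
  rw [normAvg, mul_inv_cancel_left₀ hn']

theorem sum_centred (hn : 0 < n) : ∑ i, X.centred n i = 0 := by
  have hn' : (n : ℝ) ≠ 0 := by exact_mod_cast hn.ne'
  unfold centred
  rw [Finset.sum_sub_distrib, ← Finset.smul_sum, Finset.sum_const, Finset.card_univ,
    Fintype.card_fin, ← Nat.cast_smul_eq_nsmul ℝ, smul_smul, mul_inv_cancel₀ hn', one_smul,
    rowAvg, sub_self]

theorem norm_centred_le (i : Fin n) :
    ‖X.centred n i‖ ≤ (n : ℝ)⁻¹ * (‖X n i‖ + X.normAvg n) := by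
  unfold centred
  refine (norm_sub_le _ _).trans ?_
  rw [norm_smul, norm_smul, norm_inv, Real.norm_natCast, ← mul_add]
  gcongr
  exact X.norm_rowAvg_le_normAvg n

theorem norm_centred_le_normMax (i : Fin n) :
    ‖X.centred n i‖ ≤ 2 * X.normMax n / n := by
  refine (X.norm_centred_le i).trans ?_
  rw [inv_mul_eq_div]
  gcongr
  linarith [X.norm_le_normMax i, X.normAvg_le_normMax n]

/-- One factor of each square is bounded by the maximum, the other is summed; the variance thus
involves `normMax` only linearly. -/
theorem sum_norm_sq_centred_le (hn : 0 < n) :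
    ∑ i, ‖X.centred n i‖ ^ 2 ≤ 4 * (X.normMax n * X.normAvg n) / n := by
  have hn' : (0 : ℝ) < n := by exact_mod_cast hn
  have hM := X.normMax_nonneg n
  calc _ ≤ ∑ i : Fin n, (2 * X.normMax n / n) * ((n : ℝ)⁻¹ * (‖X n i‖ + X.normAvg n)) := by
        refine Finset.sum_le_sum fun i _ => ?_
        rw [sq]
        exact mul_le_mul (X.norm_centred_le_normMax i) (X.norm_centred_le i) (norm_nonneg _)
          (by positivity)
    _ = _ := by
      rw [← Finset.mul_sum, ← Finset.mul_sum, Finset.sum_add_distrib, X.sum_norm_eq hn]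
      simp
      field_simp
      ring

/-- The exponents of the rearranged row, as a sequence. -/
noncomputable def exponents (n : ℕ) (τ : Equiv.Perm (Fin n)) (j : ℕ) : CMat d :=
  if h : j < n then (n : ℝ)⁻¹ • X n (τ ⟨j, h⟩) else 0

theorem sum_exponents_sub (τ : Equiv.Perm (Fin n)) {k : ℕ} (hk : k ≤ n) :
    ∑ j ∈ Finset.range k, (X.exponents n τ j - (n : ℝ)⁻¹ • X.rowAvg n)
      = permPartialSum (X.centred n) k τ := by
  induction k with
  | zero => simp [permPartialSum_zero]
  | succ k ih =>
    rw [Finset.sum_range_succ, ih (by omega), permPartialSum_succ _ hk, exponents,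
      dif_pos (Nat.lt_of_succ_le hk)]
    rfl

theorem sum_comp_exponents (τ : Equiv.Perm (Fin n)) (f : CMat d → ℝ) :
    ∑ j ∈ Finset.range n, f (X.exponents n τ j) = ∑ i, f ((n : ℝ)⁻¹ • X n i) := by
  rw [Finset.sum_range, ← Equiv.sum_comp τ fun i => f ((n : ℝ)⁻¹ • X n i)]
  refine Finset.sum_congr rfl fun i _ => ?_
  simp [exponents]

theorem sum_norm_exponents (τ : Equiv.Perm (Fin n)) :
    ∑ j ∈ Finset.range n, ‖X.exponents n τ j‖ = X.normAvg n := by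
  rw [X.sum_comp_exponents τ norm, normAvg, Finset.mul_sum]
  simp [norm_smul]

theorem sum_norm_sq_exponents_le (hn : 0 < n) (τ : Equiv.Perm (Fin n)) :
    ∑ j ∈ Finset.range n, ‖X.exponents n τ j‖ ^ 2 ≤ X.normAvg n * X.normMax n / n := by
  have hn' : (0 : ℝ) < n := by exact_mod_cast hn
  rw [X.sum_comp_exponents τ fun M => ‖M‖ ^ 2]
  calc _ ≤ ∑ i : Fin n, (X.normMax n / n) * ((n : ℝ)⁻¹ * ‖X n i‖) := by
        refine Finset.sum_le_sum fun i _ => ?_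
        rw [norm_smul, norm_inv, Real.norm_natCast, sq, ← inv_mul_eq_div]
        gcongr
        exact X.norm_le_normMax i
    _ = _ := by
      rw [← Finset.mul_sum, ← Finset.mul_sum, X.sum_norm_eq hn]
      field_simp

theorem prefixProd_succ_eq (τ : Equiv.Perm (Fin n)) :
    ∀ k < n, X.prefixProd n τ (k + 1)
      = X.prefixProd n τ k * NormedSpace.exp (X.exponents n τ k) := by
  intro k hk
  rw [X.prefixProd_succ τ hk, exponents, dif_pos hk]

theorem norm_prefixProd_sub_exp_le [NeZero d] (hn : 0 < n) {a eta : ℝ} (ha : ‖X.rowAvg n‖ ≤ a)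
    (τ : Equiv.Perm (Fin n)) (heta : ∀ k ≤ n, ‖permPartialSum (X.centred n) k τ‖ ≤ eta)
    {k : ℕ} (hk : k ≤ n) :
    ‖X.prefixProd n τ k - NormedSpace.exp (((k : ℝ) / n) • X.rowAvg n)‖
      ≤ Real.exp (X.normAvg n) * Real.exp a ^ 2
        * (3 * eta + 2 * Real.exp a * (X.normAvg n * X.normMax n / n)) := by
  have hn' : (0 : ℝ) < n := by exact_mod_cast hn
  have hn1 : (1 : ℝ) ≤ n := by exact_mod_cast hn
  set D := (n : ℝ)⁻¹ • X.rowAvg n with hD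
  have heta0 : 0 ≤ eta := (norm_nonneg _).trans (heta 0 (Nat.zero_le _))
  have ha0 : 0 ≤ a := (norm_nonneg _).trans ha
  have hM := X.normMax_nonneg n
  have hL := X.normAvg_nonneg n
  have hDn : ‖D‖ = ‖X.rowAvg n‖ / n := by
    rw [hD, norm_smul, norm_inv, Real.norm_natCast, inv_mul_eq_div]
  have hnD : n * ‖D‖ = ‖X.rowAvg n‖ := by rw [hDn]; field_simp
  have hDa : ‖D‖ ≤ a := by
    rw [hDn]; exact (div_le_self (norm_nonneg _) hn1).trans ha
  have hkD : ((k : ℝ) / n) • X.rowAvg n = (k : ℝ) • D := by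
    rw [hD, smul_smul, div_eq_mul_inv]
  have h := norm_expProd_sub_exp_le (X.prefixProd_zero τ) (X.prefixProd_succ_eq τ) D
    (fun k hk => by rw [hD, X.sum_exponents_sub τ hk]; exact heta k hk) hk
  rw [X.sum_norm_exponents τ, hnD] at h
  rw [hkD]
  refine h.trans ?_
  have hsq : n * (‖D‖ ^ 2 * Real.exp ‖D‖)
      ≤ Real.exp a * (X.normAvg n * X.normMax n / n) := by
    have h1 : n * ‖D‖ ^ 2 ≤ X.normAvg n * X.normMax n / n := by
      have : n * ‖D‖ ^ 2 = ‖X.rowAvg n‖ * ‖X.rowAvg n‖ / n := by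
        rw [hDn]; field_simp
      rw [this]
      gcongr
      · exact X.norm_rowAvg_le_normAvg n
      · exact (X.norm_rowAvg_le_normAvg n).trans (X.normAvg_le_normMax n)
    calc _ = Real.exp ‖D‖ * (n * ‖D‖ ^ 2) := by ring
      _ ≤ _ := by gcongr
  have hs := X.sum_norm_sq_exponents_le hn τ
  have hone : (1 : ℝ) ≤ Real.exp a := Real.one_le_exp ha0
  have hq : 0 ≤ X.normAvg n * X.normMax n / n := by positivity
  have hexp : Real.exp ‖X.rowAvg n‖ ≤ Real.exp a := Real.exp_le_exp.2 ha
  have hin : ∑ j ∈ Finset.range n, ‖X.exponents n τ j‖ ^ 2 + n * (‖D‖ ^ 2 * Real.exp ‖D‖)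
      ≤ 2 * Real.exp a * (X.normAvg n * X.normMax n / n) := by
    linarith [mul_le_mul_of_nonneg_right hone hq]
  have hpre : Real.exp (X.normAvg n) * Real.exp ‖X.rowAvg n‖ ^ 2
      ≤ Real.exp (X.normAvg n) * Real.exp a ^ 2 :=
    mul_le_mul_of_nonneg_left (pow_le_pow_left₀ (Real.exp_pos _).le hexp 2) (Real.exp_pos _).le
  have hsq0 : 0 ≤ n * (‖D‖ ^ 2 * Real.exp ‖D‖) :=
    mul_nonneg hn'.le (mul_nonneg (sq_nonneg _) (Real.exp_pos _).le)
  have hS0 : 0 ≤ ∑ j ∈ Finset.range n, ‖X.exponents n τ j‖ ^ 2 :=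
    Finset.sum_nonneg fun j _ => sq_nonneg _
  exact mul_le_mul hpre (add_le_add_right hin _)
    (add_nonneg (mul_nonneg zero_le_three heta0) (add_nonneg hS0 hsq0))
    (mul_nonneg (Real.exp_pos _).le (sq_nonneg _))

/-- Both terms lie within `exp κ - 1` of the identity, whatever the ordering. This settles rows of
small average norm, where the growth hypotheses give no control of `normMax`. -/
theorem norm_prefixProd_sub_exp_le_of_normAvg_le [NeZero d] (hn : 0 < n) {κ : ℝ}
    (hκ : X.normAvg n ≤ κ) (τ : Equiv.Perm (Fin n)) {k : ℕ} (hk : k ≤ n) :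
    ‖X.prefixProd n τ k - NormedSpace.exp (((k : ℝ) / n) • X.rowAvg n)‖
      ≤ 2 * (Real.exp κ - 1) := by
  have hn' : (0 : ℝ) < n := by exact_mod_cast hn
  have h1 : ‖X.prefixProd n τ k - 1‖ ≤ Real.exp κ - 1 := by
    refine (norm_expProd_sub_one_le (X.prefixProd_zero τ) (X.prefixProd_succ_eq τ) hk).trans ?_
    gcongr
    refine le_trans ?_ hκ
    rw [← X.sum_norm_exponents τ]
    exact Finset.sum_le_sum_of_subset_of_nonneg (Finset.range_mono hk)
      fun _ _ _ => norm_nonneg _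
  have h2 : ‖NormedSpace.exp (((k : ℝ) / n) • X.rowAvg n) - 1‖ ≤ Real.exp κ - 1 := by
    refine (norm_normedSpace_exp_sub_one_le _).trans ?_
    gcongr
    rw [norm_smul, Real.norm_of_nonneg (by positivity : (0 : ℝ) ≤ (k : ℝ) / n)]
    have : (k : ℝ) / n ≤ 1 := by
      rw [div_le_one hn']; exact_mod_cast hk
    exact (mul_le_of_le_one_left (norm_nonneg _) this).trans
      ((X.norm_rowAvg_le_normAvg n).trans hκ)
  calc _ = ‖(X.prefixProd n τ k - 1) - (NormedSpace.exp (((k : ℝ) / n) • X.rowAvg n) - 1)‖ := by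
        rw [sub_sub_sub_cancel_right]
    _ ≤ _ := norm_sub_le _ _
    _ ≤ _ := by linarith

/-! ### Counting the bad orderings of a row. -/

open Classical in
/-- The orderings of row `n` along which the products stray from the exponential of the mean. -/
noncomputable def badPerms (n : ℕ) (ε : ℝ) : Finset (Equiv.Perm (Fin n)) :=
  Finset.univ.filter fun τ => ∃ k ≤ n,
    ε ≤ ‖X.prefixProd n τ k - NormedSpace.exp (((k : ℝ) / n) • X.rowAvg n)‖

theorem exists_coordinates (d : ℕ) : ∃ m : ℕ, ∃ Φ : CMat d ≃L[ℝ] (Fin m → ℝ), ∃ K : ℝ, 0 < K ∧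
    (∀ v, ‖Φ v‖ ≤ K * ‖v‖) ∧ ∀ w, ‖Φ.symm w‖ ≤ K * ‖w‖ := by
  let Φ : CMat d ≃L[ℝ] (Fin (Module.finrank ℝ (CMat d)) → ℝ) :=
    ContinuousLinearEquiv.ofFinrankEq (by simp)
  refine ⟨_, Φ, max 1 (max ‖(Φ : CMat d →L[ℝ] Fin (Module.finrank ℝ (CMat d)) → ℝ)‖ ‖(Φ.symm : (Fin (Module.finrank ℝ (CMat d)) → ℝ) →L[ℝ] CMat d)‖),
    lt_max_of_lt_left one_pos, fun v => ?_, fun w => ?_⟩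
  · refine ((Φ : CMat d →L[ℝ] Fin (Module.finrank ℝ (CMat d)) → ℝ).le_opNorm v).trans ?_
    gcongr
    exact (le_max_left _ _).trans (le_max_right _ _)
  · refine ((Φ.symm : (Fin (Module.finrank ℝ (CMat d)) → ℝ) →L[ℝ] CMat d).le_opNorm w).trans ?_
    gcongr
    exact (le_max_right _ _).trans (le_max_right _ _)

/-- A quantitative form of the theorem for a single row. -/
theorem exists_card_badPerms_le (d : ℕ) {ε : ℝ} (hε : 0 < ε) (a : ℝ) :
    ∃ c > 0, ∃ κ > 0, ∃ M : ℝ, 0 ≤ M ∧ ∀ (X : TriArray d) (n : ℕ) (Lam : ℝ), 0 < n → 1 ≤ Lam →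
      ‖X.rowAvg n‖ ≤ a →
      (X.normAvg n ≤ κ ∨
        Lam * (Real.exp (2 * X.normAvg n) * (1 + X.normAvg n) * X.normMax n) ≤ c * n) →
      ((X.badPerms n ε).card : ℝ) ≤ M * Real.exp (-(Lam / 4)) * n ! := by
  classical
  -- For `d = 0` the identity has norm `0`, so the exponential estimates, which need `‖1‖ = 1`, are
  -- unavailable; but all matrices coincide.
  rcases Nat.eq_zero_or_pos d with rfl | hd
  · refine ⟨1, one_pos, 1, one_pos, 0, le_rfl, fun X n Lam _ _ _ _ => ?_⟩
    have : X.badPerms n ε = ∅ := by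
      unfold badPerms
      refine Finset.filter_false_of_mem fun τ _ => ?_
      rintro ⟨k, -, hk⟩
      rw [Subsingleton.elim (X.prefixProd n τ k - _) 0, norm_zero] at hk
      exact absurd hk (not_le.2 hε)
    simp [this]
  have : NeZero d := ⟨hd.ne'⟩
  obtain ⟨m, Φ, K, hK, hΦ, hΦ'⟩ := exists_coordinates d
  set e := ε / (12 * Real.exp a ^ 2) with he
  have he0 : 0 < e := by positivity
  obtain ⟨κ, hκ0, hκ⟩ : ∃ κ > 0, 2 * (Real.exp κ - 1) < ε := by
    refine ⟨Real.log (1 + ε / 4), Real.log_pos (by linarith), ?_⟩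
    rw [Real.exp_log (by positivity)]; linarith
  -- The three bounds serve, in order, the second-order error, the size of single terms and the
  -- variance. The threshold for partial sums will be `e / q`, so that `3 * (e / q)` contributes `ε
  -- / 4` to the error; its square produces the factor `exp (2 * L)`.
  refine ⟨min (ε / (8 * Real.exp a ^ 3)) (min (e / (2 * K ^ 2)) (e ^ 2 / (16 * K ^ 4))),
    by positivity, κ, hκ0, 4 * m, by positivity, fun X n Lam hn hLam ha h => ?_⟩
  have hn' : (0 : ℝ) < n := by exact_mod_cast hn
  rcases h with h | h
  · have : X.badPerms n ε = ∅ := by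
      unfold badPerms
      refine Finset.filter_false_of_mem fun τ _ => ?_
      rintro ⟨k, hk, hle⟩
      linarith [X.norm_prefixProd_sub_exp_le_of_normAvg_le hn h τ hk]
    rw [this, Finset.card_empty, Nat.cast_zero]
    positivity
  set L := X.normAvg n with hLdef
  set B := X.normMax n with hBdef
  have hL : 0 ≤ L := X.normAvg_nonneg n
  have hB : 0 ≤ B := X.normMax_nonneg n
  set q := Real.exp L with hq
  have hq1 : 1 ≤ q := Real.one_le_exp hL
  have hq2 : Real.exp (2 * L) = q ^ 2 := by rw [hq, ← Real.exp_nat_mul]; norm_num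
  rw [hq2] at h
  set c := min (ε / (8 * Real.exp a ^ 3)) (min (e / (2 * K ^ 2)) (e ^ 2 / (16 * K ^ 4)))
  have hc1 : c ≤ ε / (8 * Real.exp a ^ 3) := min_le_left _ _
  have hc2 : c ≤ e / (2 * K ^ 2) := (min_le_right _ _).trans (min_le_left _ _)
  have hc3 : c ≤ e ^ 2 / (16 * K ^ 4) := (min_le_right _ _).trans (min_le_right _ _)
  have hdiv : Lam * (q ^ 2 * (1 + L) * B) / n ≤ c := (div_le_iff₀ hn').2 h
  have hqq : q ≤ q ^ 2 := by nlinarith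
  have b1 : q * (L * B / n) ≤ c := by
    refine le_trans ?_ hdiv
    rw [← mul_div_assoc]
    refine div_le_div_of_nonneg_right ?_ hn'.le
    calc q * (L * B) ≤ q ^ 2 * ((1 + L) * B) := by gcongr; linarith
      _ = 1 * (q ^ 2 * (1 + L) * B) := by ring
      _ ≤ _ := by gcongr
  have b2 : Lam * B / n * q ≤ c := by
    refine le_trans ?_ hdiv
    rw [div_mul_eq_mul_div]
    refine div_le_div_of_nonneg_right ?_ hn'.le
    calc Lam * B * q ≤ Lam * B * (q ^ 2 * (1 + L)) := by
          gcongr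
          nlinarith [mul_nonneg (sq_nonneg q) hL]
      _ = _ := by ring
  have b3 : Lam * (B * L / n) * q ^ 2 ≤ c := by
    refine le_trans ?_ hdiv
    rw [mul_div_assoc', div_mul_eq_mul_div]
    refine div_le_div_of_nonneg_right ?_ hn'.le
    calc Lam * (B * L) * q ^ 2 ≤ Lam * (B * (1 + L)) * q ^ 2 := by gcongr; linarith
      _ = _ := by ring
  have hq0 : 0 < q := Real.exp_pos L
  have hprob := card_norm_permPartialSum_le Φ hK hΦ hΦ' (X.sum_centred hn)
    (X.norm_centred_le_normMax) (X.sum_norm_sq_centred_le hn) (zero_le_one.trans hLam)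
    (div_pos he0 hq0)
    (by
      rw [le_div_iff₀ hq0]
      calc _ = (Lam * B / n * q) * (2 * K ^ 2) := by ring
        _ ≤ c * (2 * K ^ 2) := by gcongr
        _ ≤ e := (le_div_iff₀ (by positivity)).1 hc2)
    (by
      rw [div_pow, le_div_iff₀ (by positivity)]
      calc _ = (Lam * (B * L / n) * q ^ 2) * (16 * K ^ 4) := by ring
        _ ≤ c * (16 * K ^ 4) := by gcongr
        _ ≤ e ^ 2 := (le_div_iff₀ (by positivity)).1 hc3)
  have hsub : X.badPerms n ε ⊆ Finset.univ.filter fun τ : Equiv.Perm (Fin n) =>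
      ∃ k ≤ n, e / q < ‖permPartialSum (X.centred n) k τ‖ := by
    intro τ hτ
    rw [badPerms, Finset.mem_filter] at hτ
    obtain ⟨-, k, hk, hle⟩ := hτ
    rw [Finset.mem_filter]
    refine ⟨Finset.mem_univ _, ?_⟩
    by_contra! hcon
    have h1 := X.norm_prefixProd_sub_exp_le hn ha τ hcon hk
    have h2 : q * Real.exp a ^ 2 * (3 * (e / q) + 2 * Real.exp a * (L * B / n)) ≤ ε / 2 := by
      have h3 : q * Real.exp a ^ 2 * (3 * (e / q)) = ε / 4 := by
        rw [he]; field_simp; norm_num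
      have h4 : q * Real.exp a ^ 2 * (2 * Real.exp a * (L * B / n)) ≤ ε / 4 := by
        calc _ = (q * (L * B / n)) * (2 * Real.exp a ^ 3) := by ring
          _ ≤ (ε / (8 * Real.exp a ^ 3)) * (2 * Real.exp a ^ 3) := by
            gcongr
            exact b1.trans hc1
          _ = ε / 4 := by field_simp; norm_num
      rw [mul_add]; linarith
    linarith
  calc ((X.badPerms n ε).card : ℝ) ≤ _ := by exact_mod_cast Finset.card_le_card hsub
    _ ≤ _ := hprob
    _ = _ := by ring

/-- The exponential is uniformly continuous on a compact ball containing all the arguments, and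
rounding moves `t` by at most `1 / n`. -/
theorem eventually_norm_exp_rowAvg_sub_lt {A : CMat d} (hA : Tendsto X.rowAvg atTop (𝓝 A))
    {ε : ℝ} (hε : 0 < ε) :
    ∀ᶠ n : ℕ in atTop, ∀ t ∈ Set.Icc (0 : ℝ) 1,
      ‖NormedSpace.exp (((⌊t * n⌋₊ : ℝ) / n) • X.rowAvg n) - NormedSpace.exp (t • A)‖ < ε := by
  let : NormedAlgebra ℚ (CMat d) := NormedAlgebra.restrictScalars ℚ ℝ (CMat d)
  have : ProperSpace (CMat d) := FiniteDimensional.proper ℝ (CMat d)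
  have huc : UniformContinuousOn (NormedSpace.exp : CMat d → CMat d)
      (Metric.closedBall 0 (‖A‖ + 1)) :=
    (isCompact_closedBall _ _).uniformContinuousOn_of_continuous
      NormedSpace.exp_continuous.continuousOn
  obtain ⟨r, hr, hrε⟩ := Metric.uniformContinuousOn_iff.1 huc ε hε
  have h1 : ∀ᶠ n : ℕ in atTop, ‖X.rowAvg n - A‖ < min 1 (r / 2) := by
    have := Metric.tendsto_nhds.1 hA (min 1 (r / 2)) (by positivity)
    simpa [dist_eq_norm] using this
  have h2 : ∀ᶠ n : ℕ in atTop, ‖A‖ / (n : ℝ) < r / 2 :=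
    (tendsto_const_div_atTop_nhds_zero_nat ‖A‖).eventually_lt_const (by positivity)
  filter_upwards [h1, h2, eventually_gt_atTop 0] with n hn1 hn2 hn t ht
  have hn' : (0 : ℝ) < n := by exact_mod_cast hn
  have htn : 0 ≤ t * n := mul_nonneg ht.1 hn'.le
  set s : ℝ := (⌊t * n⌋₊ : ℝ) / n with hs
  have hs0 : 0 ≤ s := by positivity
  have hst : s ≤ t := by
    rw [hs, div_le_iff₀ hn']; exact Nat.floor_le htn
  have hts : t - s ≤ 1 / n := by
    have := (Nat.lt_floor_add_one (t * n)).le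
    rw [hs, sub_le_iff_le_add, ← add_div, le_div_iff₀ hn']
    linarith
  have hs1 : s ≤ 1 := hst.trans ht.2
  have hR : ‖X.rowAvg n‖ ≤ ‖A‖ + 1 := by
    have := norm_add_le (X.rowAvg n - A) A
    rw [sub_add_cancel] at this
    linarith [hn1.trans_le (min_le_left 1 (r / 2))]
  rw [← dist_eq_norm]
  refine hrε _ ?_ _ ?_ ?_
  · rw [mem_closedBall_zero_iff, norm_smul, Real.norm_of_nonneg hs0]
    exact (mul_le_of_le_one_left (norm_nonneg _) hs1).trans hR
  · rw [mem_closedBall_zero_iff, norm_smul, Real.norm_of_nonneg ht.1]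
    linarith [mul_le_of_le_one_left (norm_nonneg A) ht.2]
  · rw [dist_eq_norm]
    have hid : s • X.rowAvg n - t • A = s • (X.rowAvg n - A) - (t - s) • A := by
      module
    rw [hid]
    refine (norm_sub_le _ _).trans_lt ?_
    rw [norm_smul, norm_smul, Real.norm_of_nonneg hs0, Real.norm_of_nonneg (sub_nonneg.2 hst)]
    have h3 : s * ‖X.rowAvg n - A‖ < r / 2 :=
      (mul_le_of_le_one_left (norm_nonneg _) hs1).trans_lt
        (hn1.trans_le (min_le_right _ _))
    have h4 : (t - s) * ‖A‖ < r / 2 := by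
      refine lt_of_le_of_lt ?_ hn2
      calc _ ≤ 1 / n * ‖A‖ := by gcongr
        _ = _ := by ring
    linarith

theorem eventually_norm_permProd_sub_lt {A : CMat d} (hA : Tendsto X.rowAvg atTop (𝓝 A))
    {ε : ℝ} (hε : 0 < ε) :
    ∀ᶠ n : ℕ in atTop, ∀ τ ∉ X.badPerms n (ε / 2), ∀ t ∈ Set.Icc (0 : ℝ) 1,
      ‖X.permProd n τ t - NormedSpace.exp (t • A)‖ < ε := by
  filter_upwards [X.eventually_norm_exp_rowAvg_sub_lt hA (half_pos hε)] with n hn τ hτ t ht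
  have hk : ⌊t * n⌋₊ ≤ n := by
    refine Nat.floor_le_of_le ?_
    exact mul_le_of_le_one_left (Nat.cast_nonneg n) ht.2
  have h1 : ‖X.prefixProd n τ ⌊t * n⌋₊
      - NormedSpace.exp (((⌊t * n⌋₊ : ℝ) / n) • X.rowAvg n)‖ < ε / 2 := by
    by_contra! hcon
    exact hτ (by simp only [badPerms, Finset.mem_filter, Finset.mem_univ, true_and]
                 exact ⟨_, hk, hcon⟩)
  rw [permProd_eq_prefixProd]
  calc _ ≤ _ := norm_sub_le_norm_sub_add_norm_sub _ (NormedSpace.exp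
        (((⌊t * n⌋₊ : ℝ) / n) • X.rowAvg n)) _
    _ < ε := by linarith [hn t ht]

end TriArray

/-! ### From counting orderings to probabilities. -/

namespace IsUniformPermSeq

variable {Ω : Type*} {σ : (n : ℕ) → Ω → Equiv.Perm (Fin n)}

theorem setOf_mem_eq_biUnion (n : ℕ) (B : Finset (Equiv.Perm (Fin n))) :
    {ω | σ n ω ∈ B} = ⋃ τ ∈ B, {ω | σ n ω = τ} := by
  ext ω; simp

variable [MeasurableSpace Ω] {P : Measure Ω}

theorem measurableSet_mem (hσ : IsUniformPermSeq P σ) (n : ℕ) (B : Finset (Equiv.Perm (Fin n))) :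
    MeasurableSet {ω | σ n ω ∈ B} := by
  rw [setOf_mem_eq_biUnion]
  exact B.measurableSet_biUnion fun τ _ => hσ.measurableSet_eq n τ

theorem measure_mem_le (hσ : IsUniformPermSeq P σ) (n : ℕ) (B : Finset (Equiv.Perm (Fin n)))
    {r : ℝ} (hr : (B.card : ℝ) ≤ r * n !) :
    P {ω | σ n ω ∈ B} ≤ ENNReal.ofReal r := by
  have hf : (0 : ℝ) < (n ! : ℕ) := by exact_mod_cast n.factorial_pos
  rw [setOf_mem_eq_biUnion]
  refine (measure_biUnion_finset_le _ _).trans ?_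
  simp_rw [hσ.prob_eq n]
  rw [Finset.sum_const, nsmul_eq_mul, ← div_eq_mul_inv]
  refine ENNReal.div_le_of_le_mul ?_
  rw [← ENNReal.ofReal_natCast B.card, ← ENNReal.ofReal_natCast (n !),
    ← ENNReal.ofReal_mul' hf.le]
  exact ENNReal.ofReal_le_ofReal hr

end IsUniformPermSeq

theorem mul_le_rpow_add_one {κ L q : ℝ} (hκ : 0 < κ) (hκL : κ ≤ L) (hq : 0 ≤ q) :
    κ ^ q * L ≤ L ^ (q + 1) := by
  have hL : 0 < L := hκ.trans_le hκL
  rw [Real.rpow_add hL, Real.rpow_one]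
  exact mul_le_mul_of_nonneg_right (Real.rpow_le_rpow hκ.le hκL hq) hL.le

namespace TriArray

variable {d : ℕ} (X : TriArray d)

/-- Away from `0`, any power of `normAvg` with exponent at least `1` dominates `1 + normAvg` up to a
constant, so the hypotheses of the theorem yield the weaker bound that the counting needs. -/
theorem growth_le {κ q : ℝ} (hκ : 0 < κ) (hq : 0 ≤ q) {n : ℕ} (hL : κ ≤ X.normAvg n) :
    Real.exp (2 * X.normAvg n) * (1 + X.normAvg n) * X.normMax n
      ≤ (1 / κ + 1) / κ ^ q
        * (X.normAvg n ^ (q + 1) * Real.exp (3 * X.normAvg n) * X.normMax n) := by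
  have hB := X.normMax_nonneg n
  set L := X.normAvg n
  have hL0 : 0 < L := hκ.trans_le hL
  have hκq : 0 < κ ^ q := Real.rpow_pos_of_pos hκ q
  have h1 : 1 + L ≤ (1 / κ + 1) * L := by
    have : 1 ≤ 1 / κ * L := by rw [div_mul_eq_mul_div, one_mul, one_le_div hκ]; exact hL
    linarith
  have h2 : L ≤ L ^ (q + 1) / κ ^ q := by
    rw [le_div_iff₀ hκq, mul_comm]; exact mul_le_rpow_add_one hκ hL hq
  calc _ ≤ Real.exp (3 * L) * ((1 / κ + 1) * (L ^ (q + 1) / κ ^ q)) * X.normMax n := by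
        gcongr
        · norm_num
        · exact h1.trans (by gcongr)
    _ = _ := by ring

/-- If the growth of the row norms is controlled at the rate `Lam n`, the probability of a bad
ordering is eventually at most a constant times `exp (-Lam n / 4)`. -/
theorem exists_eventually_card_badPerms_le {A : CMat d} (hA : Tendsto X.rowAvg atTop (𝓝 A))
    {ε q : ℝ} (hε : 0 < ε) (hq : 0 ≤ q) :
    ∃ M : ℝ, 0 ≤ M ∧ ∀ Lam : ℕ → ℝ, (∀ᶠ n in atTop, 1 ≤ Lam n) →
      ((fun n : ℕ => X.normAvg n ^ (q + 1) * Real.exp (3 * X.normAvg n) * X.normMax n)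
        =o[atTop] fun n : ℕ => (n : ℝ) / Lam n) →
      ∀ᶠ n : ℕ in atTop,
        ((X.badPerms n ε).card : ℝ) ≤ M * Real.exp (-(Lam n / 4)) * n ! := by
  obtain ⟨c, hc, κ, hκ, M, hM, h⟩ := exists_card_badPerms_le d hε (‖A‖ + 1)
  refine ⟨M, hM, fun Lam hLam ho => ?_⟩
  have ha : ∀ᶠ n in atTop, ‖X.rowAvg n‖ ≤ ‖A‖ + 1 :=
    (hA.norm.eventually_lt_const (lt_add_one _)).mono fun n hn => hn.le
  have hκq : 0 < κ ^ q := Real.rpow_pos_of_pos hκ q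
  set w := (1 / κ + 1) / κ ^ q with hw
  have hw0 : 0 < w := by positivity
  filter_upwards [hLam, ha, ho.bound (div_pos hc hw0), eventually_gt_atTop 0]
    with n hn1 hn2 hn3 hn4
  refine h X n (Lam n) hn4 hn1 hn2 ?_
  rcases le_or_gt (X.normAvg n) κ with hle | hgt
  · exact Or.inl hle
  right
  have hL0 : 0 < Lam n := zero_lt_one.trans_le hn1
  have hb := (le_abs_self _).trans hn3
  rw [Real.norm_of_nonneg (by positivity)] at hb
  calc _ ≤ Lam n * (w * (c / w * (n / Lam n))) := by
        exact mul_le_mul_of_nonneg_left ((X.growth_le hκ hq hgt.le).trans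
          (mul_le_mul_of_nonneg_left hb hw0.le)) hL0.le
    _ = c * n := by field_simp

end TriArray

theorem theorem2 (d : ℕ) (A : CMat d) (X : TriArray d)
    (hA : Tendsto X.rowAvg atTop (𝓝 A))
    (δ : ℝ) (hδ : 0 < δ)
    (h1 : (fun n : ℕ => X.normAvg n ^ (4 + δ) * Real.exp (3 * X.normAvg n) * X.normMax n)
      =o[atTop] fun n : ℕ => (n : ℝ))
    {Ω : Type*} [MeasurableSpace Ω] (P : Measure Ω) [IsProbabilityMeasure P]
    (σ : (n : ℕ) → Ω → Equiv.Perm (Fin n)) (hσ : IsUniformPermSeq P σ) :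
    (∀ ε : ℝ, 0 < ε →
      Tendsto (fun n : ℕ => P {ω | ∀ t ∈ Set.Icc (0 : ℝ) 1,
        ‖X.permProd n (σ n ω) t - NormedSpace.exp (t • A)‖ < ε}) atTop (𝓝 1)) ∧
    (((fun n : ℕ => X.normAvg n ^ 3 * Real.exp (3 * X.normAvg n) * X.normMax n)
        =o[atTop] fun n : ℕ => (n : ℝ) / Real.log n) →
      ∀ᵐ ω ∂P, TendstoUniformlyOn (fun (n : ℕ) (t : ℝ) => X.permProd n (σ n ω) t)
        (fun t : ℝ => NormedSpace.exp (t • A)) atTop (Set.Icc (0 : ℝ) 1)) := by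
  refine ⟨fun ε hε => ?_, fun h2 => ?_⟩
  · obtain ⟨M, hM, h⟩ := X.exists_eventually_card_badPerms_le hA (half_pos hε)
      (q := 3 + δ) (by positivity)
    have hbad : Tendsto (fun n => P {ω | σ n ω ∈ X.badPerms n (ε / 2)}) atTop (𝓝 0) := by
      rw [ENNReal.tendsto_nhds_zero]
      intro b hb
      have hlim : Tendsto (fun l : ℝ => ENNReal.ofReal (M * Real.exp (-(l / 4)))) atTop
          (𝓝 0) := by
        have : Tendsto (fun l : ℝ => M * Real.exp (-(l / 4))) atTop (𝓝 (M * 0)) :=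
          (Real.tendsto_exp_neg_atTop_nhds_zero.comp
            (tendsto_id.atTop_div_const (by norm_num))).const_mul M
        simpa using ENNReal.tendsto_ofReal this
      -- The rate can be chosen after `M`, since `M` does not depend on it.
      obtain ⟨l, hl, hl1⟩ :=
        ((hlim.eventually (ge_mem_nhds hb)).and (eventually_ge_atTop (1 : ℝ))).exists
      have hl0 : l ≠ 0 := by positivity
      have ho : (fun n : ℕ => X.normAvg n ^ (3 + δ + 1) * Real.exp (3 * X.normAvg n)
          * X.normMax n) =o[atTop] fun n : ℕ => (n : ℝ) / l := by
        have : 3 + δ + 1 = 4 + δ := by ring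
        rw [this]
        simp_rw [div_eq_mul_inv]
        refine h1.trans_isBigO ?_
        exact (isBigO_self_const_mul (inv_ne_zero hl0) (fun n : ℕ => (n : ℝ)) atTop).congr_right
          fun n => mul_comm _ _
      filter_upwards [h (fun _ => l) (Eventually.of_forall fun _ => hl1) ho] with n hn
      exact (hσ.measure_mem_le n _ hn).trans hl
    -- A lower bound by the complement of the bad event suffices, and only that event has to be
    -- measurable.
    have hlow : Tendsto (fun n => 1 - P {ω | σ n ω ∈ X.badPerms n (ε / 2)}) atTop (𝓝 1) := by
      simpa using ENNReal.Tendsto.sub tendsto_const_nhds hbad (Or.inl ENNReal.one_ne_top)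
    refine tendsto_of_tendsto_of_tendsto_of_le_of_le' hlow tendsto_const_nhds ?_
      (Eventually.of_forall fun n => prob_le_one)
    filter_upwards [X.eventually_norm_permProd_sub_lt hA hε] with n hn
    rw [← prob_compl_eq_one_sub (hσ.measurableSet_mem n _)]
    exact measure_mono fun ω hω => hn _ hω
  -- Countably many tolerances, so that the exceptional null sets can be united.
  · have hae : ∀ m : ℕ, ∀ᵐ ω ∂P, ∀ᶠ n in atTop,
        σ n ω ∉ X.badPerms n (1 / ((m : ℝ) + 1) / 2) := by
      intro m
      obtain ⟨M, hM, h⟩ := X.exists_eventually_card_badPerms_le hA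
        (ε := 1 / ((m : ℝ) + 1) / 2) (by positivity) (q := 2) (by norm_num)
      have hLam : ∀ᶠ n : ℕ in atTop, 1 ≤ 8 * Real.log n := by
        have := (Real.tendsto_log_atTop.comp tendsto_natCast_atTop_atTop).eventually_ge_atTop
          (1 : ℝ)
        filter_upwards [this] with n hn
        simp only [Function.comp_apply] at hn
        linarith
      have ho : (fun n : ℕ => X.normAvg n ^ ((2 : ℝ) + 1) * Real.exp (3 * X.normAvg n)
          * X.normMax n) =o[atTop] fun n : ℕ => (n : ℝ) / (8 * Real.log n) := by
        have h3 : ∀ n : ℕ, X.normAvg n ^ ((2 : ℝ) + 1) = X.normAvg n ^ 3 := by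
          intro n
          rw [← Real.rpow_natCast]; norm_num
        simp_rw [h3]
        refine h2.trans_isBigO ?_
        refine (isBigO_self_const_mul (c := (8 : ℝ)⁻¹) (by norm_num)
          (fun n : ℕ => (n : ℝ) / Real.log n) atTop).congr_right fun n => ?_
        rw [inv_mul_eq_div, div_div, mul_comm]
      obtain ⟨N, hN⟩ := eventually_atTop.1
        ((h (fun n => 8 * Real.log n) hLam ho).and (eventually_gt_atTop 0))
      -- The condition `N ≤ n` empties the early events, so the bound holds for every `n`.
      -- Borel–Cantelli needs no independence here, which is why the joint law of the permutations
      -- is irrelevant.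
      have hle : ∀ n, P {ω | N ≤ n ∧ σ n ω ∈ X.badPerms n (1 / ((m : ℝ) + 1) / 2)}
          ≤ ENNReal.ofReal (M * (1 / (n : ℝ) ^ 2)) := by
        intro n
        by_cases hn : N ≤ n
        · simp only [hn, true_and]
          refine hσ.measure_mem_le n _ ((hN n hn).1.trans (le_of_eq ?_))
          have hn0 : (0 : ℝ) < n := by exact_mod_cast (hN n hn).2
          have : -(8 * Real.log n / 4) = -(Real.log ((n : ℝ) ^ 2)) := by
            rw [Real.log_pow]; push_cast; ring
          rw [this, Real.exp_neg, Real.exp_log (by positivity), one_div]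
        · simp [hn]
      have hsum : Summable fun n : ℕ => M * (1 / (n : ℝ) ^ 2) :=
        (Real.summable_one_div_nat_pow.2 (by norm_num)).mul_left M
      have hfin : ∑' n, P {ω | N ≤ n ∧ σ n ω ∈ X.badPerms n (1 / ((m : ℝ) + 1) / 2)} ≠ ∞ :=
        ne_top_of_le_ne_top hsum.tsum_ofReal_ne_top (ENNReal.tsum_le_tsum hle)
      filter_upwards [ae_eventually_notMem hfin] with ω hω
      filter_upwards [hω, eventually_ge_atTop N] with n hn1 hn2 hmem
      exact hn1 ⟨hn2, hmem⟩
    filter_upwards [ae_all_iff.2 hae] with ω hω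
    rw [Metric.tendstoUniformlyOn_iff]
    intro ε hε
    obtain ⟨m, hm⟩ := exists_nat_one_div_lt hε
    filter_upwards [hω m, X.eventually_norm_permProd_sub_lt hA
      (ε := 1 / ((m : ℝ) + 1)) (by positivity)] with n hn1 hn2 t ht
    rw [dist_comm, dist_eq_norm]
    exact (hn2 _ hn1 t ht).trans hm
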